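/- Let $\mathcal G$ be a weighted directed graph on agents $1,\dots,n$ with adjacency matrix $A=(a_{ij})$, $a_{ij}\ge 0$, $a_{ii}=0$, where $a_{ij}>0$ means that there is a link from agent $j$ to agent $i$; let $N_i^{in}=\{j: a_{ij}>0\}$ and let $l_{ii}=\sum_j a_{ij}$ be the in-degree (the $i$-th diagonal entry of the Laplacian $L=\mathrm{diag}(\sum_j a_{ij})-A$). Let $\delta>0$ and assume that $A$ contains a $\delta$-spanning tree: there is an agent from which every other agent can be reached along directed links of weight at least $\delta$. Let $q:\mathbb R\to\mathbb R$ satisfy $|q(a)-a|\le\delta_u$ for all $a\in\mathbb R$. Let $\delta_1,\dots,\delta_n\in(0,\tfrac12)$, and let each agent $i$, with an arbitrary first triggering time $t_1^i$, choose its further triggering times arbitrarily subject to $$t^i_{k+1}\in\Big(t^i_k+\frac{\delta_i}{l_{ii}},\;t^i_k+\frac{1-\delta_i}{l_{ii}}\Big),\qquad k\ge 1$$ (no condition if $l_{ii}=0$, in which case agent $i$ has no in-neighbours and its input is $0$). For each $i$ let $x_i$ be continuous on $[t_1^i,\infty)$ and satisfy there (as a right derivative) $$\dot x_i(t)=u_i(t)=\sum_{j\in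 N_i^{in}}a_{ij}\,q\big(x_j(t^i_{k_i(t)})-x_i(t^i_{k_i(t)})\big),\qquad k_i(t)=\max\{k: t^i_k\le t\};$$ before $t_1^i$ the values of $x_i$ are arbitrary. Put $d(x)=\max_i x_i-\min_i x_i$. Then $x(t)=(x_1(t),\dots,x_n(t))$ converges exponentially to the consensus set $S=\{x\in\mathbb R^n: d(x)\le C_4\delta_u\}$: for every $t_0\ge\max_i t^i_1$ there is $K$ with $$\mathrm{dist}(x(t),S)\le K e^{-\lambda(t-t_0)}\qquad\text{for all } t\ge t_0.$$ Here $C_4>0$ and $\lambda>0$ are constants determined by $n$, $\delta,\delta_1,\dots,\delta_n$ and the in-degrees $l_{11},\dots,l_{nn}$ alone; they do not depend on the rest of the graph, on $\delta_u$, $q$, the triggering times or the trajectory. -/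

import Mathlib

namespace SelfTriggered

open Set

/-- Weighted adjacency matrix of a digraph on `n` agents: nonnegative, zero diagonal;
`A i j > 0` means that there is a link from agent `j` to agent `i`. -/
def IsAdjacency {n : ℕ} (A : Matrix (Fin n) (Fin n) ℝ) : Prop :=
  (∀ i j, 0 ≤ A i j) ∧ ∀ i, A i i = 0

/-- In-neighbours of agent `i`. -/
noncomputable def inNeighbors {n : ℕ} (A : Matrix (Fin n) (Fin n) ℝ) (i : Fin n) :
    Finset (Fin n) :=
  Finset.univ.filter fun j => 0 < A i j

/-- In-degree of agent `i`. -/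
noncomputable def inDegree {n : ℕ} (A : Matrix (Fin n) (Fin n) ℝ) (i : Fin n) : ℝ :=
  ∑ j, A i j

/-- Weighted Laplacian `L = D - A`. -/
noncomputable def laplacian {n : ℕ} (A : Matrix (Fin n) (Fin n) ℝ) :
    Matrix (Fin n) (Fin n) ℝ :=
  Matrix.diagonal (inDegree A) - A

/-- There is an agent from which every agent can be reached along directed links. -/
def HasSpanningTree {n : ℕ} (A : Matrix (Fin n) (Fin n) ℝ) : Prop :=
  ∃ r, ∀ j, Relation.ReflTransGen (fun a b => 0 < A b a) r j

/-- The `δ`-matrix of `A`: entries at least `δ` become `δ`, the others become `0`. -/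
noncomputable def deltaMatrix {n : ℕ} (δ : ℝ) (A : Matrix (Fin n) (Fin n) ℝ) :
    Matrix (Fin n) (Fin n) ℝ :=
  Matrix.of fun i j => if δ ≤ A i j then δ else 0

/-- `A` contains a `δ`-spanning tree. -/
def HasDeltaSpanningTree {n : ℕ} (δ : ℝ) (A : Matrix (Fin n) (Fin n) ℝ) : Prop :=
  HasSpanningTree (deltaMatrix δ A)

/-- Uniform quantizer with error bound `δu`; nothing else is required of `q`. -/
def IsUniformQuantizer (q : ℝ → ℝ) (δu : ℝ) : Prop :=
  ∀ a, |q a - a| ≤ δu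

/-- The distributed self-triggering rule; `t i k` is the `(k+1)`-st triggering time of agent `i`.
An agent with `l_ii = 0` has no in-neighbours, hence input zero whatever its triggering
times are, and nothing is required of them. -/
def SelfTriggeringRule {n : ℕ} (A : Matrix (Fin n) (Fin n) ℝ) (δ' : Fin n → ℝ)
    (t : Fin n → ℕ → ℝ) : Prop :=
  ∀ i, 0 < laplacian A i i → ∀ k,
    t i (k + 1) ∈ Ioo (t i k + δ' i / laplacian A i i) (t i k + (1 - δ' i) / laplacian A i i)

/-- The index `k(s) = argmax_k {t_k ≤ s}` of the latest triggering time up to `s`. -/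
noncomputable def lastIndex (t : ℕ → ℝ) (s : ℝ) : ℕ :=
  sSup {k | t k ≤ s}

/-- The input of agent `i` at time `s`: its latest own measurements of the quantized relative
positions of its in-neighbours. -/
noncomputable def sensingInput {n : ℕ} (A : Matrix (Fin n) (Fin n) ℝ) (q : ℝ → ℝ)
    (t : Fin n → ℕ → ℝ) (x : ℝ → Fin n → ℝ) (i : Fin n) (s : ℝ) : ℝ :=
  ∑ j ∈ inNeighbors A i,
    A i j * q (x (t i (lastIndex (t i) s)) j - x (t i (lastIndex (t i) s)) i)

/-- `x` solves `ẋ_i = u_i` with the quantized sensing input. Since `u_i` is piecewise constant and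
right-continuous, this means that `x_i` is continuous with right derivative `u_i`. The input of
agent `i` is defined only from its first triggering time on; no condition is put on `x_i` before. -/
def IsTrajectory {n : ℕ} (A : Matrix (Fin n) (Fin n) ℝ) (q : ℝ → ℝ)
    (t : Fin n → ℕ → ℝ) (x : ℝ → Fin n → ℝ) : Prop :=
  ∀ i, ContinuousOn (fun s => x s i) (Ici (t i 0)) ∧
    ∀ s, t i 0 ≤ s → HasDerivWithinAt (fun r => x r i) (sensingInput A q t x i s) (Ici s) s

/-- `d(x) = max_i x_i - min_i x_i`. -/
noncomputable def spread {n : ℕ} (x : Fin n → ℝ) : ℝ :=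
  (⨆ i, x i) - ⨅ i, x i

/-- The consensus set `{x | d(x) ≤ c}`. -/
def consensusSet (n : ℕ) (c : ℝ) : Set (Fin n → ℝ) :=
  {x | spread x ≤ c}

/-- On `[t₀, ∞)` the distance of `x` to `S` decays exponentially with rate `rate`. (The distance is
that of the sup norm; another norm only changes the factor `K`.) -/
def ExpConvergesTo {n : ℕ} (x : ℝ → Fin n → ℝ) (S : Set (Fin n → ℝ)) (t₀ rate : ℝ) : Prop :=
  ∃ K : ℝ, ∀ s, t₀ ≤ s → Metric.infDist (x s) S ≤ K * Real.exp (-rate * (s - t₀))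

end SelfTriggered

/-! Let `θ` be the least `δ' i`. Between two of its samplings agent `i` moves so slowly that its
state is, up to an error `δu`, a convex combination of the sampled states with weight at least `θ`
on its own. Relative to a common upper bound `U`, all deficits `U - x s i` are nonnegative; a
deficit survives each sampling up to the factor `θ` (`deficit_persists`), and over one sampling gap,
which has length at least `θ / L`, a link of weight at least `δ` passes on the fraction `θ * δ / L`
of it (`deficit_propagates`).

At some sampling time the root lies in the lower or the upper half of the range. In the first case
its deficit reaches every agent along the tree and the upper bound drops; the other case is the same
for `-x`. So over a time `T` the range shrinks by a factor `1 - c`, up to a multiple of `δu`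
(`range_contracts`). Iteration gives geometric decay down to a multiple of `δu`, and clipping turns
a small range into a small distance to the consensus set.

Since the inputs use old measurements, the bounds are kept on windows of length `H`, the longest
sampling gap. -/

namespace SelfTriggered

open Set

/-! ### Sampled systems and their sampling times -/

/-- What the convergence proof uses of a self-triggered trajectory: on each sampling interval the
state of agent `i` moves along its sampled consensus direction up to an error of rate at most
`l_ii δu`, and sampling intervals are bounded above and below. The notion is invariant under
`x ↦ -x`. -/
structure IsSampled {n : ℕ} (A : Matrix (Fin n) (Fin n) ℝ) (θ L H δu : ℝ)
    (t : Fin n → ℕ → ℝ) (t₀ : ℝ) (x : ℝ → Fin n → ℝ) : Prop where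
  weight_nonneg : ∀ i j, 0 ≤ A i j
  θ_pos : 0 < θ
  θ_le_one : θ ≤ 1
  L_pos : 0 < L
  H_pos : 0 < H
  δu_nonneg : 0 ≤ δu
  inDegree_le : ∀ i, inDegree A i ≤ L
  first_le : ∀ i, t i 0 ≤ t₀
  le_gap : ∀ i, 0 < inDegree A i → ∀ k, θ ≤ inDegree A i * (t i (k + 1) - t i k)
  gap_le : ∀ i, 0 < inDegree A i → ∀ k, inDegree A i * (t i (k + 1) - t i k) ≤ 1 - θ
  gap_le_H : ∀ i, 0 < inDegree A i → ∀ k, t i (k + 1) - t i k ≤ H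
  const : ∀ i, inDegree A i = 0 → ∀ s, t₀ ≤ s → x s i = x t₀ i
  step : ∀ i, 0 < inDegree A i → ∀ k, ∀ s ∈ Icc (t i k) (t i (k + 1)),
    |x s i - x (t i k) i - (s - t i k) * ∑ j, A i j * (x (t i k) j - x (t i k) i)| ≤
      (s - t i k) * inDegree A i * δu

namespace IsSampled

variable {n : ℕ} {A : Matrix (Fin n) (Fin n) ℝ} {θ L H δu : ℝ} {t : Fin n → ℕ → ℝ} {t₀ : ℝ}
  {x : ℝ → Fin n → ℝ}

/-- Gives lower bounds from upper bounds. The quantizer need not be odd, since only its two-sided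
error bound enters. -/
theorem neg (h : IsSampled A θ L H δu t t₀ x) :
    IsSampled A θ L H δu t t₀ (fun s i => -x s i) where
  weight_nonneg := h.weight_nonneg
  θ_pos := h.θ_pos
  θ_le_one := h.θ_le_one
  L_pos := h.L_pos
  H_pos := h.H_pos
  δu_nonneg := h.δu_nonneg
  inDegree_le := h.inDegree_le
  first_le := h.first_le
  le_gap := h.le_gap
  gap_le := h.gap_le
  gap_le_H := h.gap_le_H
  const i hi s hs := by rw [h.const i hi s hs]
  step i hi k s hs := by
    have := h.step i hi k s hs
    rw [← abs_neg] at this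
    convert this using 2
    have e : ∑ j, A i j * (-x (t i k) j - -x (t i k) i) =
        -∑ j, A i j * (x (t i k) j - x (t i k) i) := by
      rw [← Finset.sum_neg_distrib]
      exact Finset.sum_congr rfl fun j _ => by ring
    rw [e]; ring

theorem inDegree_nonneg (h : IsSampled A θ L H δu t t₀ x) (i : Fin n) : 0 ≤ inDegree A i :=
  Finset.sum_nonneg fun j _ => h.weight_nonneg i j

theorem weight_le_inDegree (h : IsSampled A θ L H δu t t₀ x) (i j : Fin n) :
    A i j ≤ inDegree A i :=
  Finset.single_le_sum (fun j _ => h.weight_nonneg i j) (Finset.mem_univ j)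

/-- Keeps sampling times from accumulating: any `N` consecutive gaps cover a time `N * (θ / L)`. -/
theorem div_le_gap (h : IsSampled A θ L H δu t t₀ x) {i : Fin n} (hi : 0 < inDegree A i) (k : ℕ) :
    θ / L ≤ t i (k + 1) - t i k := by
  have h1 := h.le_gap i hi k
  have h2 := h.inDegree_le i
  have h3 : 0 < t i (k + 1) - t i k := by
    by_contra hc
    nlinarith [h.θ_pos]
  rw [div_le_iff₀ h.L_pos]
  nlinarith

theorem gap_pos (h : IsSampled A θ L H δu t t₀ x) {i : Fin n} (hi : 0 < inDegree A i) (k : ℕ) :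
    t i k < t i (k + 1) := by
  have := h.div_le_gap hi k
  have := div_pos h.θ_pos h.L_pos
  linarith

theorem strictMono (h : IsSampled A θ L H δu t t₀ x) {i : Fin n} (hi : 0 < inDegree A i) :
    StrictMono (t i) :=
  strictMono_nat_of_lt_succ (h.gap_pos hi)

theorem add_mul_le (h : IsSampled A θ L H δu t t₀ x) {i : Fin n} (hi : 0 < inDegree A i)
    (k m : ℕ) : t i k + m * (θ / L) ≤ t i (k + m) := by
  induction m with
  | zero => simp
  | succ m ih =>
    have := h.div_le_gap hi (k + m)
    push_cast
    rw [← add_assoc]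
    linarith

theorem exists_le (h : IsSampled A θ L H δu t t₀ x) {i : Fin n} (hi : 0 < inDegree A i) (s : ℝ) :
    ∃ k, s ≤ t i k := by
  obtain ⟨m, hm⟩ := exists_nat_ge ((s - t i 0) / (θ / L))
  rw [div_le_iff₀ (div_pos h.θ_pos h.L_pos)] at hm
  have := h.add_mul_le hi 0 m
  exact ⟨0 + m, by linarith⟩

/-- Every time after `t₀` lies in a half-open sampling interval of each agent with a positive
in-degree. -/
theorem exists_mem_Ioc (h : IsSampled A θ L H δu t t₀ x) {i : Fin n} (hi : 0 < inDegree A i)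
    {s : ℝ} (hs : t₀ < s) : ∃ k, t i k < s ∧ s ≤ t i (k + 1) := by
  classical
  have hex := h.exists_le hi s
  have hspec := Nat.find_spec hex
  have h0 : Nat.find hex ≠ 0 := fun h0 => by
    rw [h0] at hspec
    linarith [h.first_le i]
  obtain ⟨k, hk⟩ := Nat.exists_eq_succ_of_ne_zero h0
  refine ⟨k, ?_, by rw [hk] at hspec; exact hspec⟩
  exact not_le.1 (Nat.find_min hex (by omega))

/-- An agent with a positive in-degree samples in every interval of length `H`. -/
theorem exists_mem_Icc (h : IsSampled A θ L H δu t t₀ x) {i : Fin n} (hi : 0 < inDegree A i)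
    {s : ℝ} (hs : t₀ < s) : ∃ k, s ≤ t i k ∧ t i k ≤ s + H := by
  obtain ⟨k, h1, h2⟩ := h.exists_mem_Ioc hi hs
  exact ⟨k + 1, h2, by linarith [h.gap_le_H i hi k]⟩

/-- Induction along the sampling times of all agents. -/
theorem sampling_induction (h : IsSampled A θ L H δu t t₀ x) {P : ℝ → Prop}
    (hP : ∀ s, (∀ i k, 0 < inDegree A i → t i k < s → P (t i k)) → P s) (s : ℝ) : P s := by
  classical
  have hex : ∀ (s : ℝ) (i : Fin n), ∃ k, 0 < inDegree A i → s ≤ t i k := fun s i => by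
    by_cases hi : 0 < inDegree A i
    · obtain ⟨k, hk⟩ := h.exists_le hi s
      exact ⟨k, fun _ => hk⟩
    · exact ⟨0, fun h' => absurd h' hi⟩
  -- `Nat.find (hex s i)` counts the samplings of agent `i` before `s` (it is 0 for in-degree 0).
  -- The total drops strictly when `s` is replaced by an earlier sampling time.
  suffices H' : ∀ N : ℕ, ∀ s, ∑ i, Nat.find (hex s i) < N → P s from H' _ s (Nat.lt_succ_self _)
  intro N
  induction N with
  | zero => intro s hs; exact absurd hs (Nat.not_lt_zero _)
  | succ N ih =>
    intro s hs
    refine hP s fun i k hi hk => ih _ (lt_of_lt_of_le ?_ (Nat.lt_succ_iff.1 hs))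
    refine Finset.sum_lt_sum (fun j _ => ?_) ⟨i, Finset.mem_univ i, ?_⟩
    · exact Nat.find_mono fun m hm hj => hk.le.trans (hm hj)
    · have h1 : Nat.find (hex (t i k) i) ≤ k := Nat.find_min' _ fun _ => le_rfl
      have h2 := Nat.find_spec (hex s i) hi
      exact h1.trans_lt ((h.strictMono hi).lt_iff_lt.1 (hk.trans_le h2))

/-! ### Deficits below a common upper bound -/

/-- On a sampling interval the deficit below a level `U` is at least a combination of the sampled
deficits, up to the quantization error. -/
theorem deficit_step (h : IsSampled A θ L H δu t t₀ x) {i : Fin n} (hi : 0 < inDegree A i) {k : ℕ}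
    {s : ℝ} (hs : s ∈ Icc (t i k) (t i (k + 1))) (U : ℝ) :
    (1 - inDegree A i * (s - t i k)) * (U - x (t i k) i) +
      (s - t i k) * ∑ j, A i j * (U - x (t i k) j) - (s - t i k) * inDegree A i * δu ≤
      U - x s i := by
  have h1 := (abs_le.1 (h.step i hi k s hs)).2
  have e : ∑ j, A i j * (x (t i k) j - x (t i k) i) =
      inDegree A i * (U - x (t i k) i) - ∑ j, A i j * (U - x (t i k) j) := by
    rw [inDegree, Finset.sum_mul, ← Finset.sum_sub_distrib]
    exact Finset.sum_congr rfl fun j _ => by ring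
  rw [e] at h1
  linarith

theorem inDegree_mul_le (h : IsSampled A θ L H δu t t₀ x) {i : Fin n} (hi : 0 < inDegree A i)
    {k : ℕ} {s : ℝ} (hs : s ∈ Icc (t i k) (t i (k + 1))) :
    inDegree A i * (s - t i k) ≤ 1 - θ :=
  (mul_le_mul_of_nonneg_left (by linarith [hs.2]) hi.le).trans (h.gap_le i hi k)

theorem error_le (h : IsSampled A θ L H δu t t₀ x) {i : Fin n} (hi : 0 < inDegree A i)
    {k : ℕ} {s : ℝ} (hs : s ∈ Icc (t i k) (t i (k + 1))) :
    (s - t i k) * inDegree A i * δu ≤ δu := by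
  have := h.inDegree_mul_le hi hs
  have := mul_le_mul_of_nonneg_right (this.trans (by linarith [h.θ_pos] : _ ≤ (1 : ℝ))) h.δu_nonneg
  linarith

/-- An upper bound on a window of length `H` propagates, growing at rate at most `L δu`. -/
theorem le_of_window (h : IsSampled A θ L H δu t t₀ x) {a M : ℝ} (ha : t₀ + H ≤ a)
    (hM : ∀ i, ∀ s ∈ Icc (a - H) a, x s i ≤ M) (s : ℝ) (hs : a - H ≤ s) (i : Fin n) :
    x s i ≤ M + L * δu * (s - (a - H)) := by
  revert hs i
  refine h.sampling_induction
    (P := fun s => a - H ≤ s → ∀ i, x s i ≤ M + L * δu * (s - (a - H))) (fun s ih hs i => ?_) s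
  have hLδ : 0 ≤ L * δu * (s - (a - H)) :=
    mul_nonneg (mul_nonneg h.L_pos.le h.δu_nonneg) (by linarith)
  have hHp := h.H_pos
  rcases le_or_gt s a with hsa | hsa
  · have := hM i s ⟨hs, hsa⟩
    linarith
  rcases (h.inDegree_nonneg i).eq_or_lt' with hi | hi
  · have e : x s i = x a i := by
      rw [h.const i hi s (by linarith), h.const i hi a (by linarith)]
    have := hM i a ⟨by linarith, le_rfl⟩
    linarith
  obtain ⟨k, hk, hk'⟩ := h.exists_mem_Ioc hi (by linarith : t₀ < s)
  have hmem : s ∈ Icc (t i k) (t i (k + 1)) := ⟨hk.le, hk'⟩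
  -- As `s > a` and gaps are at most `H`, the sampling before `s` comes after `a - H`, where the
  -- bound is available.
  have hprev := ih i k hi hk (by linarith [h.gap_le_H i hi k])
  set U := M + L * δu * (t i k - (a - H)) with hU
  have hstep := h.deficit_step hi hmem U
  have h1 := h.inDegree_mul_le hi hmem
  have h2 : 0 ≤ (1 - inDegree A i * (s - t i k)) * (U - x (t i k) i) :=
    mul_nonneg (by linarith [h.θ_pos]) (sub_nonneg.2 (hprev i))
  have h3 : 0 ≤ (s - t i k) * ∑ j, A i j * (U - x (t i k) j) :=
    mul_nonneg (by linarith) (Finset.sum_nonneg fun j _ =>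
      mul_nonneg (h.weight_nonneg i j) (sub_nonneg.2 (hprev j)))
  have : (s - t i k) * inDegree A i * δu ≤ (s - t i k) * L * δu :=
    mul_le_mul_of_nonneg_right (mul_le_mul_of_nonneg_left (h.inDegree_le i) (by linarith))
      h.δu_nonneg
  linarith

/-- A lower bound on the deficit of an agent below a common upper bound persists, losing a factor
`θ` and an error `δu` at each sampling. -/
theorem deficit_persists (h : IsSampled A θ L H δu t t₀ x) {a b U β C : ℝ}
    (hU : ∀ s ∈ Icc a b, ∀ j, x s j ≤ U) (hβ : 0 ≤ β) (hC : 0 ≤ C) {i : Fin n}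
    (hi : 0 < inDegree A i) {k : ℕ} (hk : a ≤ t i k) (hdef : β - C * δu ≤ U - x (t i k) i)
    (m : ℕ) : ∀ s, t i k ≤ s → s ≤ t i (k + m) → s ≤ b →
      θ ^ m * β - (C + m) * δu ≤ U - x s i := by
  induction m with
  | zero =>
    intro s h1 h2 _
    obtain rfl : s = t i k := le_antisymm h2 h1
    simpa using hdef
  | succ m ih =>
    intro s h1 h2 h3
    have hp : θ ^ (m + 1) * β ≤ θ ^ m * β :=
      mul_le_mul_of_nonneg_right (pow_le_pow_of_le_one h.θ_pos.le h.θ_le_one (Nat.le_succ m)) hβ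
    rcases le_total s (t i (k + m)) with hsm | hsm
    · have := ih s h1 hsm h3
      push_cast
      linarith [h.δu_nonneg]
    have hkm : t i k ≤ t i (k + m) := (h.strictMono hi).monotone (Nat.le_add_right k m)
    have hprev := ih _ hkm le_rfl (hsm.trans h3)
    have hmem : s ∈ Icc (t i (k + m)) (t i (k + m + 1)) := ⟨hsm, h2⟩
    have hUm := hU (t i (k + m)) ⟨hk.trans hkm, hsm.trans h3⟩
    have hstep := h.deficit_step hi hmem U
    have herr := h.error_le hi hmem
    have hd := h.inDegree_mul_le hi hmem
    have hsum : 0 ≤ (s - t i (k + m)) * ∑ j, A i j * (U - x (t i (k + m)) j) :=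
      mul_nonneg (by linarith) (Finset.sum_nonneg fun j _ =>
        mul_nonneg (h.weight_nonneg i j) (sub_nonneg.2 (hUm j)))
    -- The agent's weight on itself is at least `θ`; the other deficits are nonnegative and can be
    -- dropped.
    have hfac : θ * (U - x (t i (k + m)) i) ≤
        (1 - inDegree A i * (s - t i (k + m))) * (U - x (t i (k + m)) i) :=
      mul_le_mul_of_nonneg_right (by linarith) (sub_nonneg.2 (hUm i))
    have hmul := mul_le_mul_of_nonneg_left hprev h.θ_pos.le
    have hCm : θ * ((C + m) * δu) ≤ (C + m) * δu :=
      mul_le_of_le_one_left (mul_nonneg (by positivity) h.δu_nonneg) h.θ_le_one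
    push_cast
    rw [pow_succ]
    linarith

/-- A deficit of agent `j` is passed on along a link of weight at least `δ`. -/
theorem deficit_propagates (h : IsSampled A θ L H δu t t₀ x) {a b s₁ U β C δ : ℝ} {N : ℕ}
    (hU : ∀ s ∈ Icc a b, ∀ j, x s j ≤ U) (hβ : 0 ≤ β) (hC : 0 ≤ C) (hδ : 0 < δ) {i j : Fin n}
    (hij : δ ≤ A i j) (ht₀ : t₀ < s₁) (ha : a ≤ s₁) (hN : b - a ≤ N * (θ / L))
    (hb : s₁ + 2 * H ≤ b) (hdef : ∀ s ∈ Icc s₁ b, β - C * δu ≤ U - x s j) :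
    ∀ s ∈ Icc (s₁ + 2 * H) b,
      θ ^ N * (θ * δ / L) * β - (C + 1 + N) * δu ≤ U - x s i := by
  intro s hs
  have hi : 0 < inDegree A i := hδ.trans_le (hij.trans (h.weight_le_inDegree i j))
  -- Agent `i` measures `j` by time `s₁ + H` and has acted on it for a full gap by `s₁ + 2 * H`.
  obtain ⟨k, hk, hk'⟩ := h.exists_mem_Icc hi ht₀
  have hgap := h.gap_le_H i hi k
  have hHp := h.H_pos
  have hpos := h.gap_pos hi k
  have hmem : t i (k + 1) ∈ Icc (t i k) (t i (k + 1)) := ⟨hpos.le, le_rfl⟩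
  have hUk := hU (t i k) ⟨ha.trans hk, by linarith⟩
  have hstep := h.deficit_step hi hmem U
  have herr := h.error_le hi hmem
  have hd := h.inDegree_mul_le hi hmem
  have hself : 0 ≤ (1 - inDegree A i * (t i (k + 1) - t i k)) * (U - x (t i k) i) :=
    mul_nonneg (by linarith [h.θ_pos]) (sub_nonneg.2 (hUk i))
  have hsum : A i j * (U - x (t i k) j) ≤ ∑ j, A i j * (U - x (t i k) j) :=
    Finset.single_le_sum (f := fun j => A i j * (U - x (t i k) j))
      (fun j _ => mul_nonneg (h.weight_nonneg i j) (sub_nonneg.2 (hUk j))) (Finset.mem_univ j)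
  have hsum' := mul_le_mul_of_nonneg_left hsum (sub_nonneg.2 hpos.le)
  have hp0 : 0 ≤ θ * δ / L := div_nonneg (mul_nonneg h.θ_pos.le hδ.le) h.L_pos.le
  have hp1 : θ * δ / L ≤ 1 := by
    rw [div_le_one h.L_pos]
    have h1 := mul_le_of_le_one_left hδ.le h.θ_le_one
    linarith [h.weight_le_inDegree i j, h.inDegree_le i]
  have hp : θ * δ / L ≤ (t i (k + 1) - t i k) * A i j := by
    have := mul_le_mul (h.div_le_gap hi k) hij hδ.le (sub_nonneg.2 hpos.le)
    calc θ * δ / L = θ / L * δ := by ring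
      _ ≤ _ := this
  have hj := mul_le_mul_of_nonneg_right hp (sub_nonneg.2 (hUk j))
  have hj' := mul_le_mul_of_nonneg_left (hdef (t i k) ⟨hk, by linarith⟩) hp0
  have hCδ : θ * δ / L * (C * δu) ≤ C * δu :=
    mul_le_of_le_one_left (mul_nonneg hC h.δu_nonneg) hp1
  have hnext : θ * δ / L * β - (C + 1) * δu ≤ U - x (t i (k + 1)) i := by linarith
  -- `N` further samplings last beyond `b`.
  have hlate := h.add_mul_le hi (k + 1) N
  have := h.deficit_persists hU (mul_nonneg hp0 hβ) (by linarith : 0 ≤ C + 1) hi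
    (by linarith : a ≤ t i (k + 1)) hnext N s (by linarith [hs.1]) (by linarith [hs.2]) hs.2
  linarith

end IsSampled

/-! ### Spreading along the spanning tree and contraction of the range -/

/-- A set containing the root of a spanning tree is either everything or has an outgoing link. -/
theorem exists_link_of_ne_univ {α : Type*} [Fintype α] {R : α → α → Prop} {r : α}
    (hr : ∀ j, Relation.ReflTransGen R r j) {S : Finset α} (hS : r ∈ S) (hne : S ≠ Finset.univ) :
    ∃ j ∈ S, ∃ i, i ∉ S ∧ R j i := by
  by_contra! hc
  refine hne (Finset.eq_univ_iff_forall.2 fun j => ?_)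
  induction hr j with
  | refl => exact hS
  | tail _ hbc ih =>
    by_contra hn
    exact hc _ ih _ hn hbc

namespace IsSampled

variable {n : ℕ} {A : Matrix (Fin n) (Fin n) ℝ} {θ L H δu : ℝ} {t : Fin n → ℕ → ℝ} {t₀ : ℝ}
  {x : ℝ → Fin n → ℝ}

/-- A deficit of the root of a spanning tree spreads to all agents. -/
theorem deficit_spreads (h : IsSampled A θ L H δu t t₀ x) {a b s₁ U β C δ : ℝ} {N : ℕ}
    (hU : ∀ s ∈ Icc a b, ∀ j, x s j ≤ U) (hβ : 0 ≤ β) (hC : 0 ≤ C) (hδ : 0 < δ) {r : Fin n}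
    (hr : ∀ j, Relation.ReflTransGen (fun j i => δ ≤ A i j) r j) (ht₀ : t₀ < s₁) (ha : a ≤ s₁)
    (hN : b - a ≤ N * (θ / L)) (hδL : δ ≤ L) (hdef : ∀ s ∈ Icc s₁ b, β - C * δu ≤ U - x s r)
    (m : ℕ) (hb : s₁ + m * (2 * H) ≤ b) :
    ∃ S : Finset (Fin n), r ∈ S ∧ (m < S.card ∨ S = Finset.univ) ∧
      ∀ i ∈ S, ∀ s ∈ Icc (s₁ + m * (2 * H)) b,
        (θ ^ N * (θ * δ / L)) ^ m * β - (C + m * (1 + N)) * δu ≤ U - x s i := by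
  classical
  have hHp := h.H_pos
  have hκ0 : 0 ≤ θ ^ N * (θ * δ / L) :=
    mul_nonneg (pow_nonneg h.θ_pos.le N)
      (div_nonneg (mul_nonneg h.θ_pos.le hδ.le) h.L_pos.le)
  have hκ1 : θ ^ N * (θ * δ / L) ≤ 1 := by
    refine mul_le_one₀ (pow_le_one₀ h.θ_pos.le h.θ_le_one)
      (div_nonneg (mul_nonneg h.θ_pos.le hδ.le) h.L_pos.le) ?_
    rw [div_le_one h.L_pos]
    exact (mul_le_of_le_one_left hδ.le h.θ_le_one).trans hδL
  generalize hκ : θ ^ N * (θ * δ / L) = κ at *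
  induction m with
  | zero =>
    refine ⟨{r}, by simp, by simp, fun i hi s hs => ?_⟩
    obtain rfl := Finset.mem_singleton.1 hi
    simpa using hdef s (by simpa using hs)
  | succ m ih =>
    push_cast at hb
    obtain ⟨S, hrS, hcard, hS⟩ := ih (by linarith)
    have hβm : 0 ≤ κ ^ m * β := mul_nonneg (pow_nonneg hκ0 m) hβ
    -- Deficits are claimed up to the end `b`, so the members of `S` keep theirs, and each round
    -- only has to add one agent.
    have hold : ∀ i ∈ S, ∀ s ∈ Icc (s₁ + ((m + 1 : ℕ) : ℝ) * (2 * H)) b,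
        κ ^ (m + 1) * β - (C + ((m + 1 : ℕ) : ℝ) * (1 + N)) * δu ≤ U - x s i := by
      intro i hi s hs
      push_cast at hs ⊢
      have h1 := hS i hi s ⟨by linarith [hs.1], hs.2⟩
      have h2 : κ ^ (m + 1) * β ≤ κ ^ m * β :=
        mul_le_mul_of_nonneg_right (pow_le_pow_of_le_one hκ0 hκ1 (Nat.le_succ m)) hβ
      have h3 : 0 ≤ (1 + (N : ℝ)) * δu := mul_nonneg (by positivity) h.δu_nonneg
      linarith
    by_cases hne : S = Finset.univ
    · exact ⟨S, hrS, Or.inr hne, hold⟩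
    obtain ⟨j, hj, i, hi, hij⟩ := exists_link_of_ne_univ hr hrS hne
    refine ⟨insert i S, Finset.mem_insert_of_mem hrS, Or.inl ?_, fun i' hi' s hs => ?_⟩
    · rw [Finset.card_insert_of_notMem hi]
      have := hcard.resolve_right hne
      omega
    rcases Finset.mem_insert.1 hi' with rfl | hi'
    · have hm0 : 0 ≤ (m : ℝ) * (2 * H) := by positivity
      have := h.deficit_propagates hU hβm
        (by positivity : 0 ≤ C + m * (1 + (N : ℝ))) hδ hij (by linarith : t₀ < s₁ + m * (2 * H))
        (by linarith) hN (by linarith) (hS j hj) s ⟨by push_cast at hs; linarith [hs.1], hs.2⟩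
      rw [hκ] at this
      push_cast
      rw [pow_succ]
      linarith
    · exact hold i' hi' s hs

/-- If the root starts below a level, after time `2H(n+1)` all agents are strictly below an upper
bound, up to a multiple of `δu`. -/
theorem upper_decreases (h : IsSampled A θ L H δu t t₀ x) {a M δ D : ℝ} {N : ℕ} (hδ : 0 < δ)
    (hδL : δ ≤ L) {r : Fin n} (hr : ∀ j, Relation.ReflTransGen (fun j i => δ ≤ A i j) r j)
    (ha : t₀ + H ≤ a) (hN : 2 * H * (n + 1) ≤ N * (θ / L))
    (hM : ∀ i, ∀ s ∈ Icc (a - H) a, x s i ≤ M) (hD : 0 ≤ D) {s₀ : ℝ} (hs₀ : s₀ ∈ Icc a (a + H))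
    (hs₀' : inDegree A r = 0 ∨ ∃ k, s₀ = t r k) (hroot : D ≤ M - x s₀ r) :
    ∀ i, ∀ s ∈ Icc (a + 2 * H * (n + 1) - H) (a + 2 * H * (n + 1)),
      x s i ≤ M + (L * (2 * H * (n + 1) + H) + N + n * (1 + N)) * δu -
        (θ ^ N * (θ * δ / L)) ^ n * (θ ^ N * D) := by
  intro i s hs
  have hHp := h.H_pos
  have hLδ : 0 ≤ L * δu := mul_nonneg h.L_pos.le h.δu_nonneg
  -- The time splits as `H` to sample the root, `2 * H` for each of `n` rounds, and `H` for the new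
  -- window.
  have hT : 2 * H * (n + 1) = n * (2 * H) + 2 * H := by ring
  have hn0 : 0 ≤ (n : ℝ) * (2 * H) := by positivity
  set b := a + 2 * H * (n + 1) with hb
  set U := M + L * δu * (2 * H * (n + 1) + H) with hUdef
  have hU : ∀ s ∈ Icc a b, ∀ j, x s j ≤ U := fun s hs j => by
    have h1 := h.le_of_window ha hM s (by linarith [hs.1]) j
    have h2 : L * δu * (s - (a - H)) ≤ L * δu * (2 * H * (n + 1) + H) :=
      mul_le_mul_of_nonneg_left (by linarith [hs.2]) hLδ
    linarith
  have hMU : M ≤ U := by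
    have : 0 ≤ L * δu * (2 * H * (n + 1) + H) := mul_nonneg hLδ (by positivity)
    linarith
  have hbase : ∀ s ∈ Icc (a + H) b, θ ^ N * D - N * δu ≤ U - x s r := by
    intro s hs
    rcases (h.inDegree_nonneg r).eq_or_lt' with h0 | h0
    · have e : x s r = x s₀ r := by
        rw [h.const r h0 s (by linarith [hs.1]), h.const r h0 s₀ (by linarith [hs₀.1])]
      have h1 := mul_le_of_le_one_left hD (pow_le_one₀ (n := N) h.θ_pos.le h.θ_le_one)
      have h2 : 0 ≤ (N : ℝ) * δu := mul_nonneg (by positivity) h.δu_nonneg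
      linarith
    · obtain ⟨k, rfl⟩ := hs₀'.resolve_left h0.ne'
      have hlate := h.add_mul_le h0 k N
      have := h.deficit_persists hU hD le_rfl h0 hs₀.1 (by linarith) N s
        (by linarith [hs.1, hs₀.2]) (by linarith [hs.2, hs₀.1]) hs.2
      linarith
  obtain ⟨S, -, hcard, hS⟩ := h.deficit_spreads (N := N) hU
    (mul_nonneg (pow_nonneg h.θ_pos.le N) hD) (Nat.cast_nonneg N) hδ hr
    (by linarith : t₀ < a + H) (by linarith) (by linarith) hδL hbase n (by linarith)
  have hSuniv : S = Finset.univ := hcard.resolve_left fun hlt => by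
    have := S.card_le_univ
    rw [Fintype.card_fin] at this
    omega
  have := hS i (hSuniv ▸ Finset.mem_univ i) s ⟨by linarith [hs.1], hs.2⟩
  linarith

/-- The contraction of the range of the states over a time `2H(n+1)`. -/
theorem range_contracts (h : IsSampled A θ L H δu t t₀ x) {a m M δ : ℝ} {N : ℕ} (hδ : 0 < δ)
    (hδL : δ ≤ L) {r : Fin n} (hr : ∀ j, Relation.ReflTransGen (fun j i => δ ≤ A i j) r j)
    (ha : t₀ + H ≤ a) (hN : 2 * H * (n + 1) ≤ N * (θ / L))
    (hmM : m ≤ M) (hx : ∀ i, ∀ s ∈ Icc (a - H) a, x s i ∈ Icc m M) :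
    ∃ m' M', (∀ i, ∀ s ∈ Icc (a + 2 * H * (n + 1) - H) (a + 2 * H * (n + 1)),
        x s i ∈ Icc m' M') ∧
      M' - m' = (1 - (θ ^ N * (θ * δ / L)) ^ n * θ ^ N / 2) * (M - m) +
        (2 * (L * (2 * H * (n + 1) + H)) + N + n * (1 + N)) * δu := by
  have hHp := h.H_pos
  have hLδ : 0 ≤ L * δu := mul_nonneg h.L_pos.le h.δu_nonneg
  have hT : 2 * H * (n + 1) = n * (2 * H) + 2 * H := by ring
  have hn0 : 0 ≤ (n : ℝ) * (2 * H) := by positivity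
  have hM : ∀ i, ∀ s ∈ Icc (a - H) a, x s i ≤ M := fun i s hs => (hx i s hs).2
  have hm : ∀ i, ∀ s ∈ Icc (a - H) a, -x s i ≤ -m := fun i s hs => neg_le_neg (hx i s hs).1
  have hslow : ∀ s ∈ Icc (a + 2 * H * (n + 1) - H) (a + 2 * H * (n + 1)),
      L * δu * (s - (a - H)) ≤ L * δu * (2 * H * (n + 1) + H) := fun s hs =>
    mul_le_mul_of_nonneg_left (by linarith [hs.2]) hLδ
  -- A sampling time, so that the root's deficit there can be carried on by `deficit_persists`; a
  -- root with in-degree 0 stays constant and any time will do.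
  obtain ⟨s₀, hs₀, hs₀'⟩ : ∃ s₀ ∈ Icc a (a + H), inDegree A r = 0 ∨ ∃ k, s₀ = t r k := by
    rcases (h.inDegree_nonneg r).eq_or_lt' with h0 | h0
    · exact ⟨a, ⟨le_rfl, by linarith⟩, Or.inl h0⟩
    · obtain ⟨k, hk⟩ := h.exists_mem_Icc h0 (by linarith : t₀ < a)
      exact ⟨t r k, hk, Or.inr ⟨k, rfl⟩⟩
  have hD : 0 ≤ (M - m) / 2 := by linarith
  rcases le_total (x s₀ r) ((m + M) / 2) with hcase | hcase
  · have hroot : (M - m) / 2 ≤ M - x s₀ r := by linarith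
    have hnew := h.upper_decreases hδ hδL hr ha hN hM hD hs₀ hs₀' hroot
    refine ⟨m - L * δu * (2 * H * (n + 1) + H), _, fun i s hs => ⟨?_, hnew i s hs⟩, by ring⟩
    have := h.neg.le_of_window ha hm s (by linarith [hs.1]) i
    linarith [hslow s hs]
  · have hroot : (M - m) / 2 ≤ -m - -x s₀ r := by linarith
    have hnew := h.neg.upper_decreases hδ hδL hr ha hN hm hD hs₀ hs₀' hroot
    refine ⟨_, M + L * δu * (2 * H * (n + 1) + H),
      fun i s hs => ⟨neg_le.1 (hnew i s hs), ?_⟩, by ring⟩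
    have := h.le_of_window ha hM s (by linarith [hs.1]) i
    linarith [hslow s hs]

end IsSampled

end SelfTriggered

namespace SelfTriggered

open Set

/-! ### From trajectories to sampled systems -/

theorem laplacian_diag {n : ℕ} {A : Matrix (Fin n) (Fin n) ℝ} (hA : IsAdjacency A) (i : Fin n) :
    laplacian A i i = inDegree A i := by
  simp [laplacian, hA.2 i]

theorem lastIndex_eq {t : ℕ → ℝ} (ht : StrictMono t) {k : ℕ} {s : ℝ}
    (hs : s ∈ Ico (t k) (t (k + 1))) : lastIndex t s = k := by
  have : {m | t m ≤ s} = Iic k := by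
    ext m
    refine ⟨fun hm => ?_, fun hm => (ht.monotone hm).trans hs.1⟩
    exact Nat.lt_succ_iff.1 (ht.lt_iff_lt.1 (lt_of_le_of_lt hm hs.2))
  rw [lastIndex, this, csSup_Iic]

/-- A continuous function with constant right derivative is affine. -/
theorem eq_add_mul_of_hasDerivWithinAt_right {f : ℝ → ℝ} {a b c : ℝ}
    (hf : ContinuousOn f (Icc a b)) (hd : ∀ s ∈ Ico a b, HasDerivWithinAt f c (Ici s) s) :
    ∀ s ∈ Icc a b, f s = f a + (s - a) * c := by
  intro s hs
  have := constant_of_has_deriv_right_zero (f := fun s => f s - s * c)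
    (hf.sub (by fun_prop)) (fun r hr => by
      have e := (hd r hr).sub ((hasDerivWithinAt_id r (Ici r)).mul_const c)
      rw [one_mul, sub_self] at e
      exact e) s hs
  linarith

theorem abs_sum_quantized_sub_le {n : ℕ} {A : Matrix (Fin n) (Fin n) ℝ} (hA : IsAdjacency A)
    {q : ℝ → ℝ} {δu : ℝ} (hq : IsUniformQuantizer q δu) (i : Fin n) (y : Fin n → ℝ) :
    |∑ j ∈ inNeighbors A i, A i j * q (y j) - ∑ j, A i j * y j| ≤ inDegree A i * δu := by
  have e : ∑ j ∈ inNeighbors A i, A i j * q (y j) = ∑ j, A i j * q (y j) := by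
    refine Finset.sum_subset (Finset.subset_univ _) fun j _ hj => ?_
    have : A i j = 0 := le_antisymm (by simpa [inNeighbors] using hj) (hA.1 i j)
    rw [this, zero_mul]
  rw [e, ← Finset.sum_sub_distrib, inDegree, Finset.sum_mul]
  refine (Finset.abs_sum_le_sum_abs _ _).trans (Finset.sum_le_sum fun j _ => ?_)
  rw [← mul_sub, abs_mul, abs_of_nonneg (hA.1 i j)]
  exact mul_le_mul_of_nonneg_left (hq _) (hA.1 i j)

theorem IsTrajectory.isSampled {n : ℕ} {A : Matrix (Fin n) (Fin n) ℝ} (hA : IsAdjacency A)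
    {q : ℝ → ℝ} {δu : ℝ} (hq : IsUniformQuantizer q δu) {δ' : Fin n → ℝ}
    {t : Fin n → ℕ → ℝ} (ht : SelfTriggeringRule A δ' t) {x : ℝ → Fin n → ℝ}
    (hx : IsTrajectory A q t x) {t₀ θ L H : ℝ} (ht₀ : ∀ i, t i 0 ≤ t₀) (hθ : 0 < θ) (hθ1 : θ ≤ 1)
    (hθδ : ∀ i, θ ≤ δ' i) (hL : 0 < L) (hdL : ∀ i, inDegree A i ≤ L) (hH : 0 < H)
    (hdH : ∀ i, 0 < inDegree A i → 1 / inDegree A i ≤ H) :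
    IsSampled A θ L H δu t t₀ x := by
  have hgap : ∀ i, 0 < inDegree A i → ∀ k, δ' i ≤ inDegree A i * (t i (k + 1) - t i k) ∧
      inDegree A i * (t i (k + 1) - t i k) ≤ 1 - δ' i := by
    intro i hi k
    have h := ht i (by rwa [laplacian_diag hA]) k
    rw [laplacian_diag hA] at h
    constructor
    · exact (div_le_iff₀' hi).1 (by linarith [h.1])
    · exact (le_div_iff₀' hi).1 (by linarith [h.2])
  have hpos : ∀ i, 0 < inDegree A i → ∀ k, t i k < t i (k + 1) := by
    intro i hi k
    by_contra hc
    nlinarith [(hgap i hi k).1, hθδ i]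
  refine
    { weight_nonneg := hA.1
      θ_pos := hθ
      θ_le_one := hθ1
      L_pos := hL
      H_pos := hH
      δu_nonneg := (abs_nonneg _).trans (hq 0)
      inDegree_le := hdL
      first_le := ht₀
      le_gap := fun i hi k => (hθδ i).trans (hgap i hi k).1
      gap_le := fun i hi k => (hgap i hi k).2.trans (by linarith [hθδ i])
      gap_le_H := fun i hi k => ?_
      const := fun i hi s hs => ?_
      step := fun i hi k s hs => ?_ }
  · refine le_trans ?_ (hdH i hi)
    rw [le_div_iff₀' hi]
    linarith [(hgap i hi k).2, hθδ i]
  -- The input is an empty sum, whatever `lastIndex` returns for triggering times that obey no rule.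
  · have hN : inNeighbors A i = ∅ := by
      refine Finset.filter_eq_empty_iff.2 fun j _ hj => ?_
      have := (Finset.sum_eq_zero_iff_of_nonneg fun j _ => hA.1 i j).1 hi j (Finset.mem_univ j)
      exact hj.ne' this
    have := eq_add_mul_of_hasDerivWithinAt_right (f := fun r => x r i) (a := t₀) (b := s) (c := 0)
      ((hx i).1.mono fun r hr => (ht₀ i).trans hr.1) (fun r hr => by
        simpa [sensingInput, hN] using (hx i).2 r ((ht₀ i).trans hr.1)) s ⟨hs, le_rfl⟩
    simpa using this
  · have hmono : StrictMono (t i) := strictMono_nat_of_lt_succ (hpos i hi)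
    have h0 : t i 0 ≤ t i k := hmono.monotone (Nat.zero_le k)
    have := eq_add_mul_of_hasDerivWithinAt_right (f := fun r => x r i)
      (c := ∑ j ∈ inNeighbors A i, A i j * q (x (t i k) j - x (t i k) i))
      ((hx i).1.mono fun r hr => h0.trans hr.1) (fun r hr => by
        have := (hx i).2 r (h0.trans hr.1)
        rwa [sensingInput, lastIndex_eq hmono hr] at this) s hs
    have e := abs_sum_quantized_sub_le hA hq i fun j => x (t i k) j - x (t i k) i
    have hs0 : 0 ≤ s - t i k := sub_nonneg.2 hs.1
    rw [this, add_sub_cancel_left, ← mul_sub, abs_mul, abs_of_nonneg hs0, mul_assoc]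
    exact mul_le_mul_of_nonneg_left e hs0

/-! ### Distance to the consensus set and exponential rate -/

theorem spread_le_sub {n : ℕ} {y : Fin n → ℝ} {m M : ℝ} (hmM : m ≤ M)
    (hy : ∀ i, y i ∈ Icc m M) : spread y ≤ M - m := by
  rcases isEmpty_or_nonempty (Fin n) with hn | hn
  -- For `n = 0` both extrema take the default value 0.
  · simpa [spread] using hmM
  · exact sub_le_sub (ciSup_le fun i => (hy i).2) (le_ciInf fun i => (hy i).1)

/-- Clipping bounds the distance to the consensus set. -/
theorem infDist_consensusSet_le {n : ℕ} {y : Fin n → ℝ} {m M c D : ℝ} (hc : 0 ≤ c) (hD : 0 ≤ D)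
    (hy : ∀ i, y i ∈ Icc m M) (hle : M - m ≤ D + c) :
    Metric.infDist y (consensusSet n c) ≤ D := by
  have hmem : (fun i => min (y i) (m + c)) ∈ consensusSet n c := by
    have := spread_le_sub (y := fun i => min (y i) (m + c)) (by linarith : m ≤ m + c)
      fun i => ⟨le_min (hy i).1 (by linarith), min_le_right _ _⟩
    simpa [consensusSet] using this
  refine (Metric.infDist_le_dist_of_mem hmem).trans ((dist_pi_le_iff hD).2 fun i => ?_)
  rw [Real.dist_eq, abs_of_nonneg (sub_nonneg.2 (min_le_left _ _))]
  rcases min_choice (y i) (m + c) with h | h <;> rw [h] <;> linarith [(hy i).2]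

/-- A continuous family of states on a compact interval is bounded. -/
theorem exists_bounds {n : ℕ} {x : ℝ → Fin n → ℝ} {a b : ℝ}
    (hx : ∀ i, ContinuousOn (fun s => x s i) (Icc a b)) :
    ∃ R : ℝ, 0 ≤ R ∧ ∀ i, ∀ s ∈ Icc a b, x s i ∈ Icc (-R) R := by
  choose R hR using fun i => isCompact_Icc.exists_bound_of_continuousOn (hx i)
  refine ⟨∑ i, |R i|, Finset.sum_nonneg fun i _ => abs_nonneg _, fun i s hs => abs_le.1 ?_⟩
  have h1 : |R i| ≤ ∑ i, |R i| :=
    Finset.single_le_sum (fun i _ => abs_nonneg (R i)) (Finset.mem_univ i)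
  exact ((hR i s hs).trans (le_abs_self _)).trans h1

/-- Passes from contraction per period to continuous time; the factor `exp c` pays for the
unfinished period. -/
theorem one_sub_pow_le_exp {c T τ : ℝ} {k : ℕ} (hc : 0 < c) (hc1 : c ≤ 1) (hT : 0 < T)
    (hτ : τ ≤ (k + 1) * T) : (1 - c) ^ k ≤ Real.exp c * Real.exp (-(c / T) * τ) := by
  have h1 : (1 - c) ^ k ≤ Real.exp (-c) ^ k :=
    pow_le_pow_left₀ (by linarith) (Real.one_sub_le_exp_neg c) k
  refine h1.trans ?_
  rw [← Real.exp_nat_mul, ← Real.exp_add]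
  refine Real.exp_le_exp.2 ?_
  have h2 : c / T * τ ≤ c / T * ((k + 1) * T) := mul_le_mul_of_nonneg_left hτ (by positivity)
  have h3 : c / T * ((k + 1) * T) = c * (k + 1) := by field_simp
  linarith

/-- Exponential convergence of sampled systems with explicit constants: `c` is the contraction
factor over the time `T = 2H(n+1)`. -/
theorem IsSampled.expConverges {n : ℕ} {A : Matrix (Fin n) (Fin n) ℝ} {θ L H δu : ℝ}
    {t : Fin n → ℕ → ℝ} {t₀ : ℝ} {x : ℝ → Fin n → ℝ} (h : IsSampled A θ L H δu t t₀ x)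
    (hcont : ∀ i, ContinuousOn (fun s => x s i) (Ici t₀)) {δ c C T : ℝ} {N : ℕ} (hδ : 0 < δ)
    (hδL : δ ≤ L) {r : Fin n} (hr : ∀ j, Relation.ReflTransGen (fun j i => δ ≤ A i j) r j)
    (hT : T = 2 * H * (n + 1)) (hN : T ≤ N * (θ / L))
    (hc : c = (θ ^ N * (θ * δ / L)) ^ n * θ ^ N / 2)
    (hC : C = 2 * (L * (T + H)) + N + n * (1 + N)) :
    ExpConvergesTo x (consensusSet n ((C / c + 2 * (L * (T + H))) * δu)) t₀ (c / T) := by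
  have hHp := h.H_pos
  have hLp := h.L_pos
  have hθp := h.θ_pos
  have hδu := h.δu_nonneg
  have hT0 : 0 < T := by rw [hT]; positivity
  have hHT : H ≤ T := by
    have : 0 ≤ (n : ℝ) * H := by positivity
    rw [hT]; linarith
  have hc0 : 0 < c := by rw [hc]; positivity
  have hc1 : c ≤ 1 := by
    have h1 : θ ^ N ≤ 1 := pow_le_one₀ hθp.le h.θ_le_one
    have h2 : θ * δ / L ≤ 1 := by
      rw [div_le_one hLp]
      exact (mul_le_of_le_one_left hδ.le h.θ_le_one).trans hδL
    have h3 : (θ ^ N * (θ * δ / L)) ^ n ≤ 1 :=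
      pow_le_one₀ (by positivity) (mul_le_one₀ h1 (by positivity) h2)
    have h4 := mul_le_one₀ h3 (by positivity) h1
    rw [hc]; linarith
  have hC0 : 0 ≤ C := by rw [hC]; positivity
  obtain ⟨R, hR0, hR⟩ := exists_bounds fun i =>
    (hcont i).mono (Icc_subset_Ici_self : Icc t₀ (t₀ + H) ⊆ Ici t₀)
  have hiter : ∀ k : ℕ, ∃ m M, (∀ i, ∀ s ∈ Icc (t₀ + H + k * T - H) (t₀ + H + k * T),
      x s i ∈ Icc m M) ∧ M - m ≤ (1 - c) ^ k * (2 * R) + C / c * δu := by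
    intro k
    induction k with
    | zero =>
      refine ⟨-R, R, fun i s hs => hR i s (by simpa using hs), ?_⟩
      have : 0 ≤ C / c * δu := by positivity
      simp only [pow_zero]
      linarith
    | succ k ih =>
      obtain ⟨m, M, hmem, hle⟩ := ih
      have hkT : 0 ≤ (k : ℝ) * T := by positivity
      have hmM : m ≤ M := by
        have := hmem r (t₀ + H + k * T) ⟨by linarith, le_rfl⟩
        exact this.1.trans this.2
      obtain ⟨m', M', hmem', heq⟩ := h.range_contracts hδ hδL hr
        (by linarith : t₀ + H ≤ t₀ + H + k * T) (hT ▸ hN) hmM hmem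
      rw [← hT, ← hc, ← hC] at heq
      refine ⟨m', M', fun i s hs => hmem' i s ?_, ?_⟩
      · rw [← hT]
        push_cast at hs
        exact ⟨by linarith [hs.1], by linarith [hs.2]⟩
      · have h1 := mul_le_mul_of_nonneg_left hle (by linarith : 0 ≤ 1 - c)
        -- `C / c * δu` is the fixed point of `y ↦ (1 - c) * y + C * δu`.
        have h2 : c * (C / c * δu) = C * δu := by field_simp
        rw [heq, pow_succ]
        linarith
  -- `2 * R` bounds the initial range, and `exp (c / T * H)` accounts for counting periods only from
  -- `t₀ + H`.
  refine ⟨2 * R * Real.exp c * Real.exp (c / T * H), fun s hs => ?_⟩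
  have hbound : ∀ k : ℕ, s - t₀ - H ≤ (k + 1) * T → (1 - c) ^ k * (2 * R) ≤
      2 * R * Real.exp c * Real.exp (c / T * H) * Real.exp (-(c / T) * (s - t₀)) := by
    intro k hk
    have h1 := mul_le_mul_of_nonneg_right (one_sub_pow_le_exp hc0 hc1 hT0 hk)
      (by linarith : 0 ≤ 2 * R)
    refine h1.trans (le_of_eq ?_)
    have : -(c / T) * (s - t₀ - H) = c / T * H + -(c / T) * (s - t₀) := by ring
    rw [this, Real.exp_add]
    ring
  have hset : 0 ≤ (C / c + 2 * (L * (T + H))) * δu := by positivity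
  rcases le_total s (t₀ + H) with hsH | hsH
  · refine (infDist_consensusSet_le hset (by linarith : 0 ≤ 2 * R) (fun i => hR i s ⟨hs, hsH⟩)
      (by linarith)).trans ?_
    have := hbound 0 (by push_cast; linarith)
    simpa using this
  · set k := ⌊(s - t₀ - H) / T⌋₊ with hk
    have hk1 : (k : ℝ) * T ≤ s - t₀ - H :=
      (le_div_iff₀ hT0).1 (Nat.floor_le (div_nonneg (by linarith) hT0.le))
    have hk2 : s - t₀ - H ≤ (k + 1) * T :=
      ((div_lt_iff₀ hT0).1 (Nat.lt_floor_add_one _)).le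
    obtain ⟨m, M, hmem, hle⟩ := hiter k
    have hkT : 0 ≤ (k : ℝ) * T := by positivity
    have ha : t₀ + H ≤ t₀ + H + k * T := by linarith
    -- Between windows each bound drifts by at most `L * δu * (T + H)`, hence the summand `2 * (L *
    -- (T + H))` in the radius.
    have hgrow : L * δu * (s - (t₀ + H + k * T - H)) ≤ L * δu * (T + H) :=
      mul_le_mul_of_nonneg_left (by linarith) (by positivity)
    have hup := h.le_of_window ha (fun i s hs => (hmem i s hs).2) s (by linarith)
    have hlo := h.neg.le_of_window ha (fun i s hs => neg_le_neg (hmem i s hs).1) s (by linarith)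
    refine (infDist_consensusSet_le (m := m - L * δu * (T + H)) (M := M + L * δu * (T + H)) hset
      (mul_nonneg (pow_nonneg (by linarith) k) (by linarith) : 0 ≤ (1 - c) ^ k * (2 * R))
      (fun i => ⟨by linarith [hlo i], by linarith [hup i]⟩) (by linarith)).trans (hbound k hk2)

end SelfTriggered

/-! ### Choice of the constants -/

theorem theorem4 (n : ℕ) (δ : ℝ) (hδ : 0 < δ) (δ' : Fin n → ℝ)
    (hδ' : ∀ i, δ' i ∈ Set.Ioo (0 : ℝ) (1 / 2)) (l : Fin n → ℝ) :
    ∃ C₄ : ℝ, 0 < C₄ ∧ ∃ rate : ℝ, 0 < rate ∧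
      ∀ A : Matrix (Fin n) (Fin n) ℝ, SelfTriggered.IsAdjacency A →
        (∀ i, SelfTriggered.laplacian A i i = l i) →
        SelfTriggered.HasDeltaSpanningTree δ A →
      ∀ (δu : ℝ) (q : ℝ → ℝ), SelfTriggered.IsUniformQuantizer q δu →
      ∀ t : Fin n → ℕ → ℝ, SelfTriggered.SelfTriggeringRule A δ' t →
      ∀ x : ℝ → Fin n → ℝ, SelfTriggered.IsTrajectory A q t x →
      ∀ t₀ : ℝ, (∀ i, t i 0 ≤ t₀) →
        SelfTriggered.ExpConvergesTo x (SelfTriggered.consensusSet n (C₄ * δu)) t₀ rate := by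
  obtain ⟨θ, hθ, hθ1, hθδ⟩ : ∃ θ : ℝ, 0 < θ ∧ θ ≤ 1 ∧ ∀ i, θ ≤ δ' i := by
    rcases isEmpty_or_nonempty (Fin n) with hn | hn
    · exact ⟨1, one_pos, le_rfl, fun i => isEmptyElim i⟩
    · obtain ⟨i₀, hi₀⟩ := Finite.exists_min δ'
      exact ⟨δ' i₀, (hδ' i₀).1, by linarith [(hδ' i₀).2], hi₀⟩
  -- The summands `δ` and `1` give `δ ≤ L` and `0 < H`. Where `l i = 0`, the convention `1 / 0 = 0`
  -- makes the term in `H` vanish.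
  set L : ℝ := δ + ∑ i, |l i| with hL
  set H : ℝ := 1 + ∑ i, |1 / l i| with hH
  have hsumL : 0 ≤ ∑ i, |l i| := Finset.sum_nonneg fun i _ => abs_nonneg _
  have hsumH : 0 ≤ ∑ i, |1 / l i| := Finset.sum_nonneg fun i _ => abs_nonneg _
  have hL0 : 0 < L := by linarith
  have hH0 : 0 < H := by linarith
  obtain ⟨T, hT⟩ : ∃ T : ℝ, T = 2 * H * (n + 1) := ⟨_, rfl⟩
  have hT0 : 0 < T := by rw [hT]; positivity
  obtain ⟨N, hN⟩ := exists_nat_ge (T / (θ / L))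
  rw [div_le_iff₀ (div_pos hθ hL0)] at hN
  obtain ⟨c, hc⟩ : ∃ c : ℝ, c = (θ ^ N * (θ * δ / L)) ^ n * θ ^ N / 2 := ⟨_, rfl⟩
  have hc0 : 0 < c := by rw [hc]; positivity
  obtain ⟨C, hC⟩ : ∃ C : ℝ, C = 2 * (L * (T + H)) + N + n * (1 + N) := ⟨_, rfl⟩
  have hC0 : 0 < C := by rw [hC]; positivity
  refine ⟨C / c + 2 * (L * (T + H)), by positivity, c / T, by positivity, ?_⟩
  intro A hA hl htree δu q hq t ht x hx t₀ ht₀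
  have hdeg : ∀ i, SelfTriggered.inDegree A i = l i := fun i => by
    rw [← SelfTriggered.laplacian_diag hA, hl]
  have hsampled : SelfTriggered.IsSampled A θ L H δu t t₀ x := by
    refine SelfTriggered.IsTrajectory.isSampled hA hq ht hx ht₀ hθ hθ1 hθδ hL0 (fun i => ?_) hH0
      fun i _ => ?_
    · have : |l i| ≤ ∑ i, |l i| :=
        Finset.single_le_sum (fun i _ => abs_nonneg (l i)) (Finset.mem_univ i)
      rw [hdeg i]
      linarith [le_abs_self (l i)]
    · have : |1 / l i| ≤ ∑ i, |1 / l i| :=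
        Finset.single_le_sum (fun i _ => abs_nonneg (1 / l i)) (Finset.mem_univ i)
      rw [hdeg i]
      linarith [le_abs_self (1 / l i)]
  obtain ⟨r, hr⟩ := htree
  refine hsampled.expConverges (fun i => (hx i).1.mono (Set.Ici_subset_Ici.2 (ht₀ i))) hδ
    (by linarith) (r := r) (fun j => Relation.ReflTransGen.mono (fun a b hab => ?_) _ _ (hr j))
    hT hN hc hC
  by_contra hlt
  simp [SelfTriggered.deltaMatrix, hlt] at hab
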